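/- Let $f,g:\mathbb C\to\mathbb C$ be entire functions. (1) There exist a $2\times 2$ matrix $V(z)$ whose entries are entire functions and whose determinant satisfies $\det V(z)\neq 0$ for every $z\in\mathbb C$, and an entire function $p$, such that $$V(z)\begin{pmatrix} f(z)\\ g(z)\end{pmatrix}=\begin{pmatrix} p(z)\\ 0\end{pmatrix}\qquad\text{for all } z\in\mathbb C,$$ and the zeros of $p$ are exactly the common zeros of $f$ and $g$, counted with multiplicity: $\operatorname{ord}_z p=\min(\operatorname{ord}_z f,\operatorname{ord}_z g)$ for every $z\in\mathbb C$, where $\operatorname{ord}_z h\in\{0,1,2,\dots\}\cup\{\infty\}$ denotes the order of vanishing of $h$ at $z$ (equal to $0$ if $h(z)\ne 0$, and to $\infty$ if $h\equiv 0$). In particular, there are entire functions $\tilde f,\tilde g$ with $f\tilde f+g\tilde g=p$ on $\mathbb C$. (2) If $f$ and $g$ have no common zero, then there are entire functions $\tilde f,\tilde g$ with $f(z)\tilde f(z)+g(z)\tilde g(z)=1$ for all $z\in\mathbb C$. -/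

import Mathlib

open scoped Matrix

/-! For `f ≠ 0`, write `f = p u`, `g = p v` with `u`, `v` free of common zeros (`exists_entire_gcd`)
and solve `a u + b v = 1` (`exists_entire_bezout`); the matrix with rows `(a, b)` and `(-v, u)` then
has determinant 1 and sends `(f, g)` to `(p, 0)`. Both inputs are first solved on discs, where only
finitely many zeros matter and finite products of factors `z - a` suffice. Two successive solutions
differ by a correction that can be absorbed by `exists_additive_cousin`: a multiple of `(g, -f)` for
the Bézout identity, and the exponential of a holomorphic function for the gcd. The corrected
solutions agree and glue to entire functions. -/

/-! ### Splitting off finitely many common zeros. -/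

/-- `Q` is coprime, in the ring of entire functions, to every entire function that has no zero in
common with it. -/
def CoprimeToNonvanishing (Q : ℂ → ℂ) : Prop :=
  ∀ w : ℂ → ℂ, Differentiable ℂ w → (∀ z, Q z = 0 → w z ≠ 0) →
    ∃ c d : ℂ → ℂ, Differentiable ℂ c ∧ Differentiable ℂ d ∧ ∀ z, w z * c z + Q z * d z = 1

theorem coprimeToNonvanishing_one : CoprimeToNonvanishing 1 := fun _ _ _ ↦
  ⟨0, 1, differentiable_const 0, differentiable_const 1, by simp⟩

theorem CoprimeToNonvanishing.mul {P Q : ℂ → ℂ} (hP : CoprimeToNonvanishing P)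
    (hQ : CoprimeToNonvanishing Q) : CoprimeToNonvanishing (P * Q) := by
  intro w hw h
  obtain ⟨a, b, ha, hb, hab⟩ := hP w hw fun z hz ↦ h z (by simp [hz])
  obtain ⟨c, d, hc, hd, hcd⟩ := hQ w hw fun z hz ↦ h z (by simp [hz])
  refine ⟨fun z ↦ a z * (w z * c z + Q z * d z) + P z * b z * c z, fun z ↦ b z * d z, ?_,
    hb.mul hd, fun z ↦ ?_⟩
  -- `P` itself is not assumed entire, but `P b = 1 - w a` is.
  · have hP1 : Differentiable ℂ fun z ↦ P z * b z := by
      have : (fun z ↦ P z * b z) = fun z ↦ 1 - w z * a z := by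
        ext z; linear_combination hab z
      rw [this]; fun_prop
    simp only [hcd, mul_one]
    fun_prop
  · simp only [Pi.mul_apply]
    linear_combination hab z + P z * b z * hcd z + w z * a z * hcd z

theorem exists_entire_mul_sub {u : ℂ → ℂ} (hu : Differentiable ℂ u) (a : ℂ) :
    ∃ v : ℂ → ℂ, Differentiable ℂ v ∧ ∀ z, u z = u a + (z - a) * v z := by
  refine ⟨dslope u a, ?_, fun z ↦ ?_⟩
  · rw [← differentiableOn_univ] at hu ⊢
    exact (Complex.differentiableOn_dslope Filter.univ_mem).2 hu
  · have := sub_smul_dslope u a z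
    rw [smul_eq_mul] at this
    rw [this]; ring

theorem coprimeToNonvanishing_sub (a : ℂ) : CoprimeToNonvanishing fun z ↦ z - a := by
  intro w hw h
  have ha : w a ≠ 0 := h a (sub_self a)
  obtain ⟨v, hv, hwv⟩ := exists_entire_mul_sub hw a
  refine ⟨fun _ ↦ (w a)⁻¹, fun z ↦ -(v z * (w a)⁻¹), by fun_prop, by fun_prop, fun z ↦ ?_⟩
  rw [hwv z]; field_simp; ring

/-- Dividing both functions by `z - a` lowers the order of `u` at `a`, which is finite because `u ≠
0`; `v` may vanish identically. -/
theorem exists_factor_no_common_zero_at {u v : ℂ → ℂ} (hu : Differentiable ℂ u)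
    (hv : Differentiable ℂ v) (hu0 : u ≠ 0) (a : ℂ) :
    ∃ Q u' v' : ℂ → ℂ, Differentiable ℂ Q ∧ Differentiable ℂ u' ∧ Differentiable ℂ v' ∧
      u = Q * u' ∧ v = Q * v' ∧ ¬ (u' a = 0 ∧ v' a = 0) ∧ CoprimeToNonvanishing Q := by
  have htop : analyticOrderAt u a ≠ ⊤ := fun h ↦ hu0 <|
    AnalyticOnNhd.eq_of_eventuallyEq (fun z _ ↦ hu.analyticAt z) (fun _ _ ↦ analyticAt_const)
      (analyticOrderAt_eq_top.1 h)
  obtain ⟨n, hn⟩ := ENat.ne_top_iff_exists.1 htop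
  induction n generalizing u v with
  | zero =>
    refine ⟨1, u, v, differentiable_const 1, hu, hv, by simp, by simp, fun h ↦ ?_,
      coprimeToNonvanishing_one⟩
    exact (hu.analyticAt a).analyticOrderAt_eq_zero.1 hn.symm h.1
  | succ n ih =>
    by_cases h : u a = 0 ∧ v a = 0
    · obtain ⟨u₁, hu₁, hu₁'⟩ := exists_entire_mul_sub hu a
      obtain ⟨v₁, hv₁, hv₁'⟩ := exists_entire_mul_sub hv a
      have e : u = (fun z ↦ z - a) * u₁ := by ext z; simp [hu₁' z, h.1]
      have e' : v = (fun z ↦ z - a) * v₁ := by ext z; simp [hv₁' z, h.2]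
      have hs : Differentiable ℂ fun z : ℂ ↦ z - a := by fun_prop
      have hord : analyticOrderAt u a = 1 + analyticOrderAt u₁ a := by
        rw [e, analyticOrderAt_mul (hs.analyticAt a) (hu₁.analyticAt a)]
        congr 1
        exact analyticOrderAt_id_sub_const_self
      have hord' : (n : ℕ∞) = analyticOrderAt u₁ a := by
        rw [hord, Nat.cast_succ, add_comm] at hn
        exact WithTop.add_left_cancel ENat.one_ne_top hn
      obtain ⟨Q, u', v', hQ, hu', hv', eu, ev, hne, hc⟩ :=
        ih hu₁ hv₁ (fun h0 ↦ hu0 (by simp [e, h0])) (by simp [← hord']) hord'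
      refine ⟨(fun z ↦ z - a) * Q, u', v', hs.mul hQ, hu', hv', ?_, ?_, hne,
        (coprimeToNonvanishing_sub a).mul hc⟩
      · rw [e, eu, mul_assoc]
      · rw [e', ev, mul_assoc]
    · exact ⟨1, u, v, differentiable_const 1, hu, hv, by simp, by simp, h,
        coprimeToNonvanishing_one⟩

theorem exists_factor_no_common_zero_finset {u v : ℂ → ℂ} (hu : Differentiable ℂ u)
    (hv : Differentiable ℂ v) (hu0 : u ≠ 0) (Z : Finset ℂ) :
    ∃ Q u' v' : ℂ → ℂ, Differentiable ℂ Q ∧ Differentiable ℂ u' ∧ Differentiable ℂ v' ∧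
      u = Q * u' ∧ v = Q * v' ∧ (∀ a ∈ Z, ¬ (u' a = 0 ∧ v' a = 0)) ∧
      CoprimeToNonvanishing Q := by
  classical
  induction Z using Finset.induction_on with
  | empty =>
    exact ⟨1, u, v, differentiable_const 1, hu, hv, by simp, by simp, by simp,
        coprimeToNonvanishing_one⟩
  | insert a Z _ ih =>
    obtain ⟨Q, u', v', hQ, hu', hv', eu, ev, hne, hc⟩ := ih
    obtain ⟨R, u'', v'', hR, hu'', hv'', eu', ev', hne', hc'⟩ :=
      exists_factor_no_common_zero_at hu' hv' (fun h0 ↦ hu0 (by simp [eu, h0])) a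
    refine ⟨Q * R, u'', v'', hQ.mul hR, hu'', hv'', ?_, ?_, ?_, hc.mul hc'⟩
    · rw [eu, eu', mul_assoc]
    · rw [ev, ev', mul_assoc]
    · rintro b hb ⟨h1, h2⟩
      rcases Finset.mem_insert.1 hb with rfl | hb
      · exact hne' ⟨h1, h2⟩
      · exact hne b hb ⟨by simp [eu', h1], by simp [ev', h2]⟩

theorem finite_zeros_inter_isCompact {u : ℂ → ℂ} (hu : Differentiable ℂ u) (hu0 : u ≠ 0)
    {K : Set ℂ} (hK : IsCompact K) : (K ∩ {z | u z = 0}).Finite := by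
  by_contra h
  obtain ⟨a, -, ha⟩ := Set.Infinite.exists_accPt_of_subset_isCompact h hK Set.inter_subset_left
  refine hu0 (AnalyticOnNhd.eq_of_frequently_eq (z₀ := a) (fun z _ ↦ hu.analyticAt z)
    (fun _ _ ↦ analyticAt_const) ?_)
  exact (accPt_iff_frequently_nhdsNE.1 ha).mono fun z hz ↦ hz.2

theorem exists_factor_no_common_zero_of_isCompact {u v : ℂ → ℂ} (hu : Differentiable ℂ u)
    (hv : Differentiable ℂ v) (hu0 : u ≠ 0) {K : Set ℂ} (hK : IsCompact K) :
    ∃ Q u' v' : ℂ → ℂ, Differentiable ℂ Q ∧ Differentiable ℂ u' ∧ Differentiable ℂ v' ∧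
      u = Q * u' ∧ v = Q * v' ∧ (∀ a ∈ K, ¬ (u' a = 0 ∧ v' a = 0)) ∧
      CoprimeToNonvanishing Q := by
  obtain ⟨Q, u', v', hQ, hu', hv', eu, ev, hne, hc⟩ := exists_factor_no_common_zero_finset hu hv hu0
    (finite_zeros_inter_isCompact hu hu0 hK).toFinset
  refine ⟨Q, u', v', hQ, hu', hv', eu, ev, fun a ha h ↦ hne a ?_ h, hc⟩
  simp [ha, eu, h.1]

/-- Bézout identity on a compact set. -/
theorem exists_bezout_on_isCompact {f g : ℂ → ℂ} (hf : Differentiable ℂ f)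
    (hg : Differentiable ℂ g) (hf0 : f ≠ 0) (h : ∀ z, ¬ (f z = 0 ∧ g z = 0))
    {K : Set ℂ} (hK : IsCompact K) :
    ∃ a b : ℂ → ℂ, DifferentiableOn ℂ a K ∧ DifferentiableOn ℂ b K ∧
      ∀ z ∈ K, f z * a z + g z * b z = 1 := by
  -- For the pair `(f, f)`, the common zeros are the zeros of `f`, so the cofactor `u = v` has none
  -- on `K`.
  obtain ⟨Q, u, v, hQ, hu, hv, eu, ev, hne, hc⟩ :=
    exists_factor_no_common_zero_of_isCompact hf hf hf0 hK
  obtain ⟨c, d, hc, hd, hcd⟩ := hc g hg fun z hz hgz ↦ h z ⟨by simp [eu, hz], hgz⟩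
  have huv : u = v := by
    have hmul : ∀ z ∈ Set.univ, Q z * (u - v) z = 0 := fun z _ ↦ by
      have := congrFun (eu.symm.trans ev) z
      simp only [Pi.mul_apply, Pi.sub_apply] at this ⊢
      linear_combination this
    rcases AnalyticOnNhd.eq_zero_or_eq_zero_of_mul_eq_zero (fun z _ ↦ hQ.analyticAt z)
      (fun z _ ↦ (hu.sub hv).analyticAt z) hmul isPreconnected_univ with h0 | h0
    · exact absurd (by ext z; simp [eu, h0 z trivial]) hf0
    · exact funext fun z ↦ sub_eq_zero.1 (h0 z trivial)
  have huK : ∀ z ∈ K, u z ≠ 0 := fun z hz h0 ↦ hne z hz ⟨h0, huv ▸ h0⟩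
  refine ⟨fun z ↦ d z / u z, c, hd.differentiableOn.div hu.differentiableOn huK,
    hc.differentiableOn, fun z hz ↦ ?_⟩
  have := huK z hz
  rw [eu, Pi.mul_apply]
  field_simp
  linear_combination hcd z

/-! ### Approximation, the additive Cousin problem and gluing on discs. -/

theorem exists_entire_approx_on_ball {h : ℂ → ℂ} {r s : ℝ} (hs : s < r)
    (hh : DifferentiableOn ℂ h (Metric.ball 0 r)) {ε : ℝ} (hε : 0 < ε) :
    ∃ k : ℂ → ℂ, Differentiable ℂ k ∧ ∀ z ∈ Metric.ball (0 : ℂ) s, ‖h z - k z‖ ≤ ε := by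
  rcases le_or_gt s 0 with hs0 | hs0
  · exact ⟨0, differentiable_const 0, by simp [Metric.ball_eq_empty.2 hs0]⟩
  obtain ⟨t, hst, htr⟩ := exists_between hs
  lift t to NNReal using (hs0.trans hst).le
  lift s to NNReal using hs0.le
  have hp := DifferentiableOn.hasFPowerSeriesOnBall
    (hh.mono (Metric.closedBall_subset_ball htr)) (by exact_mod_cast hs0.trans hst)
  have := hp.tendstoUniformlyOn (r' := s) (by exact_mod_cast hst)
  obtain ⟨n, hn⟩ := (Metric.tendstoUniformlyOn_iff.1 this ε hε).exists
  refine ⟨fun z ↦ (cauchyPowerSeries h 0 t).partialSum n z, ?_, fun z hz ↦ ?_⟩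
  · simp only [FormalMultilinearSeries.partialSum]
    refine Differentiable.fun_sum fun i _ ↦ ?_
    simp only [FormalMultilinearSeries.apply_eq_pow_smul_coeff]
    fun_prop
  · have := (hn z hz).le
    rwa [zero_add, dist_eq_norm] at this

theorem exists_additive_cousin (h : ℕ → ℂ → ℂ)
    (hh : ∀ n : ℕ, DifferentiableOn ℂ (h n) (Metric.ball 0 (n + 1))) :
    ∃ c : ℕ → ℂ → ℂ, (∀ n : ℕ, DifferentiableOn ℂ (c n) (Metric.ball 0 n)) ∧
      ∀ n : ℕ, ∀ z ∈ Metric.ball (0 : ℂ) n, c n z = h n z + c (n + 1) z := by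
  choose k hk hhk using fun n : ℕ ↦ exists_entire_approx_on_ball (lt_add_one (n : ℝ)) (hh n)
    (ε := (1 / 2) ^ n) (by positivity)
  have hsum : Summable fun n : ℕ ↦ (1 / 2 : ℝ) ^ n := summable_geometric_two
  have hball {m n : ℕ} (hmn : m ≤ n) : Metric.ball (0 : ℂ) m ⊆ Metric.ball 0 n :=
    Metric.ball_subset_ball (by exact_mod_cast hmn)
  have hle (n i : ℕ) : ∀ z ∈ Metric.ball (0 : ℂ) n,
      ‖h (i + n) z - k (i + n) z‖ ≤ (1 / 2 : ℝ) ^ (i + n) := fun z hz ↦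
    hhk _ z (hball (Nat.le_add_left n i) hz)
  have hsum' (n : ℕ) : Summable fun i : ℕ ↦ (1 / 2 : ℝ) ^ (i + n) :=
    (summable_nat_add_iff n).2 hsum
  -- Formally `c n` is the divergent tail sum of the `h i`, `i ≥ n`. Subtracting every entire `k i`
  -- makes it converge and leaves the differences `c n - c (n + 1) = h n` unchanged.
  refine ⟨fun n z ↦ (∑' i, (h (i + n) z - k (i + n) z)) - ∑ i ∈ Finset.range n, k i z,
    fun n ↦ ?_, fun n z hz ↦ ?_⟩
  · refine DifferentiableOn.fun_sub ?_
      (DifferentiableOn.fun_sum fun i _ ↦ (hk i).differentiableOn)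
    refine Complex.differentiableOn_tsum_of_summable_norm (hsum' n) (fun i ↦ ?_)
      Metric.isOpen_ball (hle n)
    refine ((hh _).mono ?_).sub (hk _).differentiableOn
    exact_mod_cast hball (show n ≤ i + n + 1 by lia)
  · have hs : Summable fun i ↦ h (i + n) z - k (i + n) z :=
      Summable.of_norm_bounded (hsum' n) fun i ↦ hle n i z hz
    simp only [hs.tsum_eq_zero_add, Finset.sum_range_succ, zero_add, add_assoc, add_comm 1 n]
    ring

theorem exists_entire_glue (φ : ℕ → ℂ → ℂ)
    (hφ : ∀ n : ℕ, DifferentiableOn ℂ (φ n) (Metric.ball 0 n))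
    (hc : ∀ n : ℕ, ∀ z ∈ Metric.ball (0 : ℂ) n, φ n z = φ (n + 1) z) :
    ∃ ψ : ℂ → ℂ, Differentiable ℂ ψ ∧ ∀ n : ℕ, ∀ z ∈ Metric.ball (0 : ℂ) n, ψ z = φ n z := by
  have hball {m n : ℕ} (hmn : m ≤ n) : Metric.ball (0 : ℂ) m ⊆ Metric.ball 0 n :=
    Metric.ball_subset_ball (by exact_mod_cast hmn)
  have hc' (m n : ℕ) (hmn : m ≤ n) : ∀ z ∈ Metric.ball (0 : ℂ) m, φ m z = φ n z := by
    induction n, hmn using Nat.le_induction with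
    | base => exact fun _ _ ↦ rfl
    | succ n hmn ih => exact fun z hz ↦ (ih z hz).trans (hc n z (hball hmn hz))
  choose N hN using fun z : ℂ ↦ exists_nat_gt ‖z‖
  have key : ∀ n : ℕ, ∀ z ∈ Metric.ball (0 : ℂ) n, φ (N z) z = φ n z := fun n z hz ↦ by
    have hz' : z ∈ Metric.ball (0 : ℂ) (N z) := by simpa using hN z
    rcases le_total (N z) n with h | h
    · exact hc' _ _ h z hz'
    · exact (hc' _ _ h z hz).symm
  refine ⟨fun z ↦ φ (N z) z, fun z ↦ ?_, key⟩
  have hz : Metric.ball (0 : ℂ) (N z) ∈ nhds z := Metric.isOpen_ball.mem_nhds (by simpa using hN z)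
  refine ((hφ (N z)).differentiableAt hz).congr_of_eventuallyEq ?_
  filter_upwards [hz] with w hw using key (N z) w hw

/-! ### Global Bézout identity and gcd. -/

theorem exists_log_on_ball {q : ℂ → ℂ} {r : ℝ} (hq : DifferentiableOn ℂ q (Metric.ball 0 r))
    (hq0 : ∀ z ∈ Metric.ball (0 : ℂ) r, q z ≠ 0) :
    ∃ h : ℂ → ℂ, DifferentiableOn ℂ h (Metric.ball 0 r) ∧
      ∀ z ∈ Metric.ball (0 : ℂ) r, q z = Complex.exp (h z) := by
  rcases le_or_gt r 0 with hr | hr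
  · exact ⟨0, differentiableOn_const 0, by simp [Metric.ball_eq_empty.2 hr]⟩
  obtain ⟨F, hF⟩ := ((hq.deriv Metric.isOpen_ball).div hq hq0).isExactOn_ball
  have h0 : (0 : ℂ) ∈ Metric.ball (0 : ℂ) r := Metric.mem_ball_self hr
  have hconst : ∀ z ∈ Metric.ball (0 : ℂ) r,
      q z * Complex.exp (-F z) = q 0 * Complex.exp (-F 0) := by
    intro z hz
    refine Metric.isOpen_ball.is_const_of_deriv_eq_zero (f := fun z ↦ q z * Complex.exp (-F z))
      (convex_ball 0 r).isPreconnected ?_ ?_ hz h0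
    · exact fun w hw ↦ (((hq w hw).mul ((hF w hw).differentiableAt.neg.cexp.differentiableWithinAt)))
    · intro w hw
      have h1 := (hq.differentiableAt (Metric.isOpen_ball.mem_nhds hw)).hasDerivAt.mul
        (hF w hw).neg.cexp
      refine h1.deriv.trans ?_
      have := hq0 w hw
      simp only [Pi.div_apply]
      field_simp
      simp
  refine ⟨fun z ↦ F z + (Complex.log (q 0) - F 0), ?_, fun z hz ↦ ?_⟩
  · exact fun w hw ↦ ((hF w hw).differentiableAt.add_const _).differentiableWithinAt
  · have := hconst z hz
    rw [Complex.exp_add, Complex.exp_sub, Complex.exp_log (hq0 0 h0)]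
    rw [Complex.exp_neg, Complex.exp_neg] at this
    field_simp at this ⊢
    linear_combination this

/-- **Bézout identity for entire functions.** -/
theorem exists_entire_bezout {f g : ℂ → ℂ} (hf : Differentiable ℂ f)
    (hg : Differentiable ℂ g) (hf0 : f ≠ 0) (h : ∀ z, ¬ (f z = 0 ∧ g z = 0)) :
    ∃ a b : ℂ → ℂ, Differentiable ℂ a ∧ Differentiable ℂ b ∧ ∀ z, f z * a z + g z * b z = 1 := by
  choose a b ha hb hab using fun n : ℕ ↦ exists_bezout_on_isCompact hf hg hf0 h
    (isCompact_closedBall (0 : ℂ) ((n : ℝ) + 1))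
  have hsub {x : ℝ} {n : ℕ} (hx : x ≤ n + 1) :
      Metric.ball (0 : ℂ) x ⊆ Metric.closedBall 0 ((n : ℝ) + 1) :=
    (Metric.ball_subset_ball hx).trans Metric.ball_subset_closedBall
  -- Since both pairs solve the identity, this determinant `h` satisfies `a (n + 1) - a n = g h` and
  -- `b (n + 1) - b n = -f h`.
  obtain ⟨c, hc, hcc⟩ := exists_additive_cousin
    (fun n z ↦ a (n + 1) z * b n z - a n z * b (n + 1) z) fun n ↦ by
      have h0 := hsub (n := n) le_rfl
      have h1 := hsub (n := n + 1) (x := (n : ℝ) + 1) (by push_cast; linarith)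
      exact (((ha (n + 1)).mono h1).mul ((hb n).mono h0)).sub
        (((ha n).mono h0).mul ((hb (n + 1)).mono h1))
  have hn (n : ℕ) := hsub (n := n) (x := n) (by linarith)
  have hn' (n : ℕ) := hsub (n := n + 1) (x := n) (by push_cast; linarith)
  obtain ⟨A, hA, hA'⟩ := exists_entire_glue (fun n z ↦ a n z + g z * c n z)
    (fun n ↦ ((ha n).mono (hn n)).add (hg.differentiableOn.mul (hc n))) fun n z hz ↦ by
      have e := hab n z (hn n hz)
      have e' := hab (n + 1) z (hn' n hz)
      simp only [hcc n z hz]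
      linear_combination a (n + 1) z * e - a n z * e'
  obtain ⟨B, hB, hB'⟩ := exists_entire_glue (fun n z ↦ b n z - f z * c n z)
    (fun n ↦ ((hb n).mono (hn n)).sub (hf.differentiableOn.mul (hc n))) fun n z hz ↦ by
      have e := hab n z (hn n hz)
      have e' := hab (n + 1) z (hn' n hz)
      simp only [hcc n z hz]
      linear_combination b (n + 1) z * e - b n z * e'
  refine ⟨A, B, hA, hB, fun z ↦ ?_⟩
  obtain ⟨n, hz⟩ := exists_nat_gt ‖z‖
  replace hz : z ∈ Metric.ball (0 : ℂ) n := by simpa using hz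
  rw [hA' n z hz, hB' n z hz]
  linear_combination hab n z (hn n hz)

/-- **Greatest common divisors of entire functions.** -/
theorem exists_entire_gcd {f g : ℂ → ℂ} (hf : Differentiable ℂ f)
    (hg : Differentiable ℂ g) (hf0 : f ≠ 0) :
    ∃ p u v : ℂ → ℂ, Differentiable ℂ p ∧ Differentiable ℂ u ∧ Differentiable ℂ v ∧
      f = p * u ∧ g = p * v ∧ ∀ z, ¬ (u z = 0 ∧ v z = 0) := by
  let S := {t : (ℂ → ℂ) × (ℂ → ℂ) × (ℂ → ℂ) // Differentiable ℂ t.1 ∧ Differentiable ℂ t.2.1 ∧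
    Differentiable ℂ t.2.2 ∧ f = t.1 * t.2.1 ∧ g = t.1 * t.2.2}
  have step (n : ℕ) (t : S) : ∃ (t' : S) (Q : ℂ → ℂ), Differentiable ℂ Q ∧
      t'.1.1 = t.1.1 * Q ∧ t.1.2.1 = Q * t'.1.2.1 ∧ t.1.2.2 = Q * t'.1.2.2 ∧
      ∀ z ∈ Metric.ball (0 : ℂ) n, ¬ (t'.1.2.1 z = 0 ∧ t'.1.2.2 z = 0) := by
    obtain ⟨⟨p, u, v⟩, hp, hu, hv, e, e'⟩ := t
    obtain ⟨Q, u', v', hQ, hu', hv', eu, ev, hne, -⟩ :=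
      exists_factor_no_common_zero_of_isCompact hu hv (fun h0 : u = 0 ↦ hf0 (by simp [e, h0]))
        (isCompact_closedBall (0 : ℂ) n)
    refine ⟨⟨⟨p * Q, u', v'⟩, hp.mul hQ, hu', hv', ?_, ?_⟩, Q, hQ, rfl, eu, ev, fun z hz ↦
      hne z (Metric.ball_subset_closedBall hz)⟩
    · simp only [mul_assoc, ← eu, e]
    · simp only [mul_assoc, ← ev, e']
  choose next Q hQ h1 h2 h3 h4 using step
  let t₀ : S := ⟨⟨1, f, g⟩, differentiable_const 1, hf, hg, by simp, by simp⟩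
  -- The index runs one ahead: `T n` has no common zeros on the disc of radius `n + 1`, so the next
  -- factor extracted has a logarithm there, as the Cousin lemma requires.
  let T : ℕ → S := fun n ↦ Nat.rec (next 1 t₀) (fun n t ↦ next (n + 2) t) n
  let R : ℕ → ℂ → ℂ := fun n ↦ Q (n + 2) (T n)
  have hT (n : ℕ) : ∀ z ∈ Metric.ball (0 : ℂ) (n + 1),
      ¬ ((T n).1.2.1 z = 0 ∧ (T n).1.2.2 z = 0) := by
    cases n with
    | zero => exact fun z hz ↦ h4 1 t₀ z (by simpa using hz)
    | succ n =>
      have := h4 (n + 2) (T n)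
      push_cast at this ⊢
      rwa [add_assoc, one_add_one_eq_two]
  have hR (n : ℕ) : ∀ z ∈ Metric.ball (0 : ℂ) (n + 1), R n z ≠ 0 := fun z hz h0 ↦ by
    refine hT n z hz ⟨?_, ?_⟩
    · rw [h2 (n + 2) (T n), Pi.mul_apply, show Q (n + 2) (T n) z = 0 from h0, zero_mul]
    · rw [h3 (n + 2) (T n), Pi.mul_apply, show Q (n + 2) (T n) z = 0 from h0, zero_mul]
  choose l hl hRl using fun n ↦ exists_log_on_ball (hQ (n + 2) (T n)).differentiableOn (hR n)
  obtain ⟨c, hc, hcc⟩ := exists_additive_cousin l hl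
  have hRl' (n : ℕ) : ∀ z ∈ Metric.ball (0 : ℂ) n, Q (n + 2) (T n) z = Complex.exp (l n z) :=
    fun z hz ↦ hRl n z (Metric.ball_subset_ball (by linarith) hz)
  obtain ⟨p, hp, hp'⟩ := exists_entire_glue (fun n z ↦ (T n).1.1 z * Complex.exp (c n z))
    (fun n ↦ (T n).2.1.differentiableOn.mul (hc n).cexp) fun n z hz ↦ by
      have e : (T (n + 1)).1.1 z = (T n).1.1 z * Q (n + 2) (T n) z :=
        congrFun (h1 (n + 2) (T n)) z
      simp only [e, hcc n z hz, hRl' n z hz, Complex.exp_add, mul_assoc]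
  obtain ⟨u, hu, hu'⟩ := exists_entire_glue (fun n z ↦ (T n).1.2.1 z * Complex.exp (-c n z))
    (fun n ↦ (T n).2.2.1.differentiableOn.mul (hc n).neg.cexp) fun n z hz ↦ by
      have e : (T n).1.2.1 z = Q (n + 2) (T n) z * (T (n + 1)).1.2.1 z :=
        congrFun (h2 (n + 2) (T n)) z
      simp only [e, hcc n z hz, hRl' n z hz, neg_add, Complex.exp_add, Complex.exp_neg]
      field_simp
  obtain ⟨v, hv, hv'⟩ := exists_entire_glue (fun n z ↦ (T n).1.2.2 z * Complex.exp (-c n z))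
    (fun n ↦ (T n).2.2.2.1.differentiableOn.mul (hc n).neg.cexp) fun n z hz ↦ by
      have e : (T n).1.2.2 z = Q (n + 2) (T n) z * (T (n + 1)).1.2.2 z :=
        congrFun (h3 (n + 2) (T n)) z
      simp only [e, hcc n z hz, hRl' n z hz, neg_add, Complex.exp_add, Complex.exp_neg]
      field_simp
  have hN (z : ℂ) : ∃ n : ℕ, z ∈ Metric.ball (0 : ℂ) n := by
    simpa using exists_nat_gt ‖z‖
  refine ⟨p, u, v, hp, hu, hv, ?_, ?_, fun z ↦ ?_⟩
  · ext z
    obtain ⟨n, hz⟩ := hN z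
    have e : f z = (T n).1.1 z * (T n).1.2.1 z := congrFun (T n).2.2.2.2.1 z
    rw [Pi.mul_apply, hp' n z hz, hu' n z hz, e, Complex.exp_neg]
    field_simp
  · ext z
    obtain ⟨n, hz⟩ := hN z
    have e : g z = (T n).1.1 z * (T n).1.2.2 z := congrFun (T n).2.2.2.2.2 z
    rw [Pi.mul_apply, hp' n z hz, hv' n z hz, e, Complex.exp_neg]
    field_simp
  · obtain ⟨n, hz⟩ := hN z
    rw [hu' n z hz, hv' n z hz]
    simpa [Complex.exp_ne_zero] using hT n z (Metric.ball_subset_ball (by linarith) hz)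

theorem entire_gcd_order {f g p u v : ℂ → ℂ} (hp : Differentiable ℂ p) (hu : Differentiable ℂ u)
    (hv : Differentiable ℂ v) (hf : f = p * u) (hg : g = p * v)
    {z : ℂ} (h : ¬ (u z = 0 ∧ v z = 0)) :
    analyticOrderAt p z = min (analyticOrderAt f z) (analyticOrderAt g z) := by
  rw [hf, hg, analyticOrderAt_mul (hp.analyticAt z) (hu.analyticAt z),
    analyticOrderAt_mul (hp.analyticAt z) (hv.analyticAt z)]
  rcases not_and_or.1 h with h | h
  · rw [(hu.analyticAt z).analyticOrderAt_eq_zero.2 h, add_zero, min_eq_left le_self_add]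
  · rw [(hv.analyticAt z).analyticOrderAt_eq_zero.2 h, add_zero, min_eq_right le_self_add]

/-! ### Row reduction and conclusion. -/

theorem exists_entire_row_reduction {f g : ℂ → ℂ} (hf : Differentiable ℂ f)
    (hg : Differentiable ℂ g) :
    ∃ (V : ℂ → Matrix (Fin 2) (Fin 2) ℂ) (p : ℂ → ℂ),
      (∀ i j, Differentiable ℂ (fun z => V z i j)) ∧ (∀ z, (V z).det ≠ 0) ∧
      Differentiable ℂ p ∧ (∀ z, V z *ᵥ ![f z, g z] = ![p z, 0]) ∧
      (∀ z, analyticOrderAt p z = min (analyticOrderAt f z) (analyticOrderAt g z)) := by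
  by_cases hf0 : f = 0
  · refine ⟨fun _ ↦ !![0, 1; 1, 0], g, fun i j ↦ differentiable_const _, by simp, hg, ?_, ?_⟩
    · intro z
      ext i
      fin_cases i <;> simp [hf0, Matrix.mulVec]
    · intro z
      have h0 : analyticOrderAt f z = ⊤ := analyticOrderAt_eq_top.2 (by simp [hf0])
      rw [h0, min_top_left]
  · obtain ⟨p, u, v, hp, hu, hv, e, e', hne⟩ := exists_entire_gcd hf hg hf0
    obtain ⟨a, b, ha, hb, hab⟩ :=
      exists_entire_bezout hu hv (fun h0 ↦ hf0 (by simp [e, h0])) hne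
    refine ⟨fun z ↦ !![a z, b z; -v z, u z], p, fun i j ↦ ?_, fun z ↦ ?_, hp, fun z ↦ ?_,
      fun z ↦ entire_gcd_order hp hu hv e e' (hne z)⟩
    · fin_cases i <;> fin_cases j
      exacts [ha, hb, hv.neg, hu]
    · rw [Matrix.det_fin_two_of, show a z * u z - b z * -v z = 1 by linear_combination hab z]
      exact one_ne_zero
    · ext i
      fin_cases i
      · simp [Matrix.mulVec, e, e']
        linear_combination p z * hab z
      · simp [Matrix.mulVec, e, e']
        ring

theorem mainTheorem8 (f g : ℂ → ℂ) (hf : Differentiable ℂ f) (hg : Differentiable ℂ g) :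
    (∃ (V : ℂ → Matrix (Fin 2) (Fin 2) ℂ) (p : ℂ → ℂ),
      (∀ i j, Differentiable ℂ (fun z => V z i j)) ∧
      (∀ z, (V z).det ≠ 0) ∧
      Differentiable ℂ p ∧
      (∀ z, V z *ᵥ ![f z, g z] = ![p z, 0]) ∧
      (∀ z, analyticOrderAt p z = min (analyticOrderAt f z) (analyticOrderAt g z)) ∧
      (∃ ft gt : ℂ → ℂ, Differentiable ℂ ft ∧ Differentiable ℂ gt ∧
        ∀ z, f z * ft z + g z * gt z = p z)) ∧
    ((∀ z, ¬ (f z = 0 ∧ g z = 0)) →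
      ∃ ft gt : ℂ → ℂ, Differentiable ℂ ft ∧ Differentiable ℂ gt ∧
        ∀ z, f z * ft z + g z * gt z = 1) := by
  obtain ⟨V, p, hV, hdet, hp, hVp, hord⟩ := exists_entire_row_reduction hf hg
  have hrow : ∀ z, f z * V z 0 0 + g z * V z 0 1 = p z := fun z ↦ by
    have := congrFun (hVp z) 0
    simp only [Matrix.mulVec, dotProduct, Fin.sum_univ_two, Matrix.cons_val_zero,
      Matrix.cons_val_one] at this
    linear_combination this
  refine ⟨⟨V, p, hV, hdet, hp, hVp, hord, _, _, hV 0 0, hV 0 1, hrow⟩, fun h ↦ ?_⟩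
  -- `V z` is invertible, so a zero of `p` would be a common zero of `f` and `g`.
  have hp0 : ∀ z, p z ≠ 0 := fun z hz ↦ h z <| by
    have h0 := Matrix.eq_zero_of_mulVec_eq_zero (hdet z) ((hVp z).trans (by simp [hz]))
    exact ⟨congrFun h0 0, congrFun h0 1⟩
  refine ⟨fun z ↦ V z 0 0 / p z, fun z ↦ V z 0 1 / p z, (hV 0 0).div hp hp0, (hV 0 1).div hp hp0,
    fun z ↦ ?_⟩
  have := hp0 z
  field_simp
  linear_combination hrow z
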